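/- Conventions. Let $\gamma=(x,y,z):\mathbb R\to\mathbb S^2$ be a smooth curve parametrized by arc length with $x\ge 0$, and let $\psi(s,t)=(x(s)\cos t,\,x(s)\sin t,\,y(s),\,z(s))\in\mathbb S^3$, $(s,t)\in\mathbb R^2$, be the rotational surface it generates. Let $k_1,k_2$ be its principal curvatures in $\mathbb S^3$ with respect to the unit normal pointing away from the axis of rotation (so $k_1=-\sqrt{1-x^2-\dot x^2}/x\le 0$ along the parallels), $H=\frac{1}{2}(k_1+k_2)$ and $K=k_1k_2$. For $a>0$, $b\neq 0$, call $\psi$ a rotational linear Weingarten surface $M_\alpha$ (with $c=0$) if $aH+bK=0$ everywhere and $$\frac a2\,x\sqrt{1-x^2-\dot x^2}+\frac b2\,(x^2+\dot x^2)=\alpha .$$ Put $\alpha_0=\frac14\big(\sqrt{a^2+b^2}+b\big)$ and $\alpha_1=\frac{b(a^2+2b^2)}{a^2+4b^2}$. A surface is isoparametric if its principal curvatures are constant. Theorem. There is a family of complete immersed rotational linear Weingarten surfaces in $\mathbb S^3$ that contains no isoparametric surface. More precisely, for all $a>0$ and $b\ne0$: (1) $\max\{0,\frac b2\}\le\max\{0,\alpha_1\}<\alpha_0$,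 and $\max\{0,\alpha_1\}=\max\{0,\frac b2\}=0$ if $b<0$; (2) for every $\alpha\in(\max\{0,\alpha_1\},\alpha_0)$ there is a surface $M_\alpha$ as above, with profile curve defined on all of $\mathbb R$, which is a smooth immersion into $\mathbb S^3$, complete in the induced metric, and not isoparametric; (3) for every $\alpha\in(\max\{0,\frac b2\},\alpha_0)$, every surface $M_\alpha$ as above, with profile curve defined on all of $\mathbb R$, is a smooth immersion into $\mathbb S^3$, complete in the induced metric, and not isoparametric. -/

import Mathlib

open Set Filter Topology

noncomputable section

/-- Euclidean four-space; the ambient sphere `S³` is its unit sphere. -/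
abbrev E4 : Type := EuclideanSpace ℝ (Fin 4)

/-! ### Parametrized surfaces in the unit sphere of `E4`

The parameter domain is the whole plane `ℝ × ℝ`. -/

/-- First fundamental form (pull-back metric) of `ψ` at `p`. -/
def firstForm (ψ : ℝ × ℝ → E4) (p v w : ℝ × ℝ) : ℝ :=
  inner ℝ (fderiv ℝ ψ p v) (fderiv ℝ ψ p w)

/-- `ψ` is a smooth immersion into the unit sphere `S³`. -/
structure IsSphereImmersion (ψ : ℝ × ℝ → E4) : Prop where
  smooth : ContDiff ℝ (⊤ : ℕ∞) ψ
  sphere : ∀ p, ‖ψ p‖ = 1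
  immersion : ∀ p, Function.Injective (fderiv ℝ ψ p)

/-- `N` is a smooth unit normal field along `ψ`, tangent to `S³`. -/
structure IsUnitNormal (ψ N : ℝ × ℝ → E4) : Prop where
  smooth : ContDiff ℝ (⊤ : ℕ∞) N
  unit : ∀ p, ‖N p‖ = 1
  tangent_sphere : ∀ p, inner ℝ (N p) (ψ p) = 0
  normal : ∀ p v, inner ℝ (N p) (fderiv ℝ ψ p v) = 0

/-- Second fundamental form of `ψ` in `S³` with respect to `N`: since `N` is tangent to `S³`,
it is the `N`-component of the second derivative of `ψ`. -/
def secondForm (ψ N : ℝ × ℝ → E4) (p v w : ℝ × ℝ) : ℝ :=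
  inner ℝ (fderiv ℝ (fderiv ℝ ψ) p v w) (N p)

/-- `k` is a principal curvature at `p`: an eigenvalue of the second fundamental form relative
to the first one. -/
def IsPrincipalCurvature (ψ N : ℝ × ℝ → E4) (p : ℝ × ℝ) (k : ℝ) : Prop :=
  ∃ v : ℝ × ℝ, v ≠ 0 ∧ ∀ w, secondForm ψ N p v w = k * firstForm ψ p v w

/-- Area density squared `E G - F²`. -/
def areaSq (ψ : ℝ × ℝ → E4) (p : ℝ × ℝ) : ℝ :=
  firstForm ψ p (1, 0) (1, 0) * firstForm ψ p (0, 1) (0, 1) - firstForm ψ p (1, 0) (0, 1) ^ 2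

/-- Mean curvature, half the trace of the shape operator (half the sum of the principal
curvatures). -/
def meanCurv (ψ N : ℝ × ℝ → E4) (p : ℝ × ℝ) : ℝ :=
  (firstForm ψ p (1, 0) (1, 0) * secondForm ψ N p (0, 1) (0, 1)
      - 2 * firstForm ψ p (1, 0) (0, 1) * secondForm ψ N p (1, 0) (0, 1)
      + firstForm ψ p (0, 1) (0, 1) * secondForm ψ N p (1, 0) (1, 0)) / (2 * areaSq ψ p)

/-- Gauss (Gauss-Kronecker) curvature, the determinant of the shape operator (the product of the
principal curvatures). -/
def gaussCurv (ψ N : ℝ × ℝ → E4) (p : ℝ × ℝ) : ℝ :=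
  (secondForm ψ N p (1, 0) (1, 0) * secondForm ψ N p (0, 1) (0, 1)
      - secondForm ψ N p (1, 0) (0, 1) ^ 2) / areaSq ψ p

/-- A surface is isoparametric if its principal curvatures are constant. -/
def IsIsoparametric (ψ : ℝ × ℝ → E4) : Prop :=
  ∃ N, IsUnitNormal ψ N ∧ ∃ k₁ k₂ : ℝ, ∀ p, {k | IsPrincipalCurvature ψ N p k} = {k₁, k₂}

/-- Length of the curve `σ` on `[0, 1]` in the metric induced by `ψ`. -/
def inducedLength (ψ : ℝ × ℝ → E4) (σ : ℝ → ℝ × ℝ) : ℝ :=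
  ∫ t in (0 : ℝ)..1, Real.sqrt (firstForm ψ (σ t) (deriv σ t) (deriv σ t))

/-- Riemannian distance of the metric induced by `ψ`: infimum of lengths of `C¹` curves. -/
def inducedDist (ψ : ℝ × ℝ → E4) (p q : ℝ × ℝ) : ℝ :=
  sInf {l | ∃ σ : ℝ → ℝ × ℝ, ContDiff ℝ 1 σ ∧ σ 0 = p ∧ σ 1 = q ∧ l = inducedLength ψ σ}

/-- The metric induced by `ψ` is complete: every Cauchy sequence of the Riemannian distance
converges. -/
def IsInducedComplete (ψ : ℝ × ℝ → E4) : Prop :=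
  ∀ u : ℕ → ℝ × ℝ,
    (∀ ε > 0, ∃ n₀, ∀ m ≥ n₀, ∀ n ≥ n₀, inducedDist ψ (u m) (u n) < ε) →
      ∃ p, Tendsto (fun n => inducedDist ψ (u n) p) atTop (𝓝 0)

/-! ### Rotational surfaces -/

/-- `(x, y, z)` is a smooth curve in `S²`, parametrized by arc length over all of `ℝ`, with
`x ≥ 0`. -/
structure IsProfileCurve (x y z : ℝ → ℝ) : Prop where
  smooth_x : ContDiff ℝ (⊤ : ℕ∞) x
  smooth_y : ContDiff ℝ (⊤ : ℕ∞) y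
  smooth_z : ContDiff ℝ (⊤ : ℕ∞) z
  nonneg : ∀ s, 0 ≤ x s
  sphere : ∀ s, x s ^ 2 + y s ^ 2 + z s ^ 2 = 1
  unit_speed : ∀ s, deriv x s ^ 2 + deriv y s ^ 2 + deriv z s ^ 2 = 1

/-- The rotational surface generated by the profile curve `(x, y, z)`. -/
def rotSurface (x y z : ℝ → ℝ) (p : ℝ × ℝ) : E4 :=
  !₂[x p.1 * Real.cos p.2, x p.1 * Real.sin p.2, y p.1, z p.1]

/-- The profile curve `(x, y, z)` generates a rotational linear Weingarten surface
`a H + b K = c` with parameter `α`.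

The sign of `H` depends on the unit normal `N`; it is the one that points away from the axis of
rotation, for which the principal curvature along the parallels is
`-√(1 - x² - ẋ²) / x ≤ 0`. -/
structure IsRLWS (a b c α : ℝ) (x y z : ℝ → ℝ) (N : ℝ × ℝ → E4) : Prop where
  profile : IsProfileCurve x y z
  normal : IsUnitNormal (rotSurface x y z) N
  outward : ∀ p : ℝ × ℝ, 0 ≤ Real.cos p.2 * N p 0 + Real.sin p.2 * N p 1
  weingarten : ∀ p, a * meanCurv (rotSurface x y z) N p + b * gaussCurv (rotSurface x y z) N p = c
  level : ∀ s, a / 2 * x s * Real.sqrt (1 - x s ^ 2 - deriv x s ^ 2)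
    + b / 2 * (x s ^ 2 + deriv x s ^ 2) + c / 2 * x s ^ 2 = α

/-- The largest value `α₀` of the parameter. -/
def alphaZero (a b c : ℝ) : ℝ :=
  Real.sqrt (a ^ 2 + (b + c) ^ 2) / 4 + (b + c) / 4

/-- For `c = 0` and `b > 0`, the value of the parameter at and below which the equation for `ẍ`
degenerates somewhere along the level curve (negative, hence irrelevant, if `b < 0`). -/
def alphaOne (a b : ℝ) : ℝ :=
  b * (a ^ 2 + 2 * b ^ 2) / (a ^ 2 + 4 * b ^ 2)

end

/-! Write `k = √(1 - x² - ẋ²)`. The principal curvatures are `-k/x` along the parallels and `(ẍ +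
x)/k` along the profiles, so everything reduces to the functions `x` and `k`.

The level equation reads `a x k = 2α - b (x² + ẋ²)`. For `α > max 0 (b/2)` its right side has a
positive lower bound, so `x` and `k` do too (`exists_le_of_level`). Hence the surface is immersed,
and its metric `ds² + x² dt²` is bi-Lipschitz to the flat plane, so complete. If the surface were
isoparametric, `k/x` would be constant, and the level equation would make `x` constant. For constant
`x`, the Weingarten equation forces `(4α - b)² = a² + b²`, which `α < α₀` excludes
(`not_isIsoparametric`).

For existence, put `u = k²` and `β = 2α - b`. The level equation gives `x = (β + b u)/(a k)`, and
`x² + ẋ² + k² = 1` becomes `a² u ẋ² = a² (u - u²) - (β + b u)²`. The right side is a concave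
quadratic in `u`, so `u = m + r cos θ` uniformizes the level curve and leaves a scalar autonomous
equation for `θ`. That equation degenerates where `β = b u`, which `α > α₁` rules out
(`pos_of_level_region`, `exists_global_solution`). A polar angle then recovers `y` and `z`
(`exists_isRLWS`). -/

/-! ### Derivatives, fundamental forms and curvatures of rotational surfaces. -/

/-- The derivative of `rotSurface x y z` along the parallels. -/
noncomputable def rotParallel (x : ℝ → ℝ) (p : ℝ × ℝ) : E4 :=
  !₂[-(x p.1 * Real.sin p.2), x p.1 * Real.cos p.2, 0, 0]

theorem hasFDerivAt_rotSurface {x y z : ℝ → ℝ} {x' y' z' : ℝ} {p : ℝ × ℝ}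
    (hx : HasDerivAt x x' p.1) (hy : HasDerivAt y y' p.1) (hz : HasDerivAt z z' p.1) :
    HasFDerivAt (rotSurface x y z)
      ((ContinuousLinearMap.fst ℝ ℝ ℝ).smulRight
          (!₂[x' * Real.cos p.2, x' * Real.sin p.2, y', z'] : E4) +
        (ContinuousLinearMap.snd ℝ ℝ ℝ).smulRight (rotParallel x p)) p := by
  have h1 : HasFDerivAt (fun q : ℝ × ℝ => q.1) (ContinuousLinearMap.fst ℝ ℝ ℝ) p := hasFDerivAt_fst
  have h2 : HasFDerivAt (fun q : ℝ × ℝ => q.2) (ContinuousLinearMap.snd ℝ ℝ ℝ) p := hasFDerivAt_snd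
  have hx1 := hx.comp_hasFDerivAt p h1
  have hy1 := hy.comp_hasFDerivAt p h1
  have hz1 := hz.comp_hasFDerivAt p h1
  have hc := (Real.hasDerivAt_cos p.2).comp_hasFDerivAt p h2
  have hs := (Real.hasDerivAt_sin p.2).comp_hasFDerivAt p h2
  rw [← hasFDerivWithinAt_univ, hasFDerivWithinAt_euclidean]
  intro i
  rw [hasFDerivWithinAt_univ]
  fin_cases i
  · refine (hx1.mul hc).congr_fderiv ?_
    ext <;> simp [rotParallel, mul_comm]
  · refine (hx1.mul hs).congr_fderiv ?_
    ext <;> simp [rotParallel, mul_comm]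
  · refine hy1.congr_fderiv ?_
    ext <;> simp [rotParallel]
  · refine hz1.congr_fderiv ?_
    ext <;> simp [rotParallel]

theorem hasFDerivAt_rotParallel {x : ℝ → ℝ} {x' : ℝ} {p : ℝ × ℝ} (hx : HasDerivAt x x' p.1) :
    HasFDerivAt (rotParallel x)
      ((ContinuousLinearMap.fst ℝ ℝ ℝ).smulRight
          (!₂[-(x' * Real.sin p.2), x' * Real.cos p.2, 0, 0] : E4) +
        (ContinuousLinearMap.snd ℝ ℝ ℝ).smulRight
          (!₂[-(x p.1 * Real.cos p.2), -(x p.1 * Real.sin p.2), 0, 0] : E4)) p := by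
  have h1 : HasFDerivAt (fun q : ℝ × ℝ => q.1) (ContinuousLinearMap.fst ℝ ℝ ℝ) p := hasFDerivAt_fst
  have h2 : HasFDerivAt (fun q : ℝ × ℝ => q.2) (ContinuousLinearMap.snd ℝ ℝ ℝ) p := hasFDerivAt_snd
  have hx1 := hx.comp_hasFDerivAt p h1
  have hc := (Real.hasDerivAt_cos p.2).comp_hasFDerivAt p h2
  have hs := (Real.hasDerivAt_sin p.2).comp_hasFDerivAt p h2
  rw [← hasFDerivWithinAt_univ, hasFDerivWithinAt_euclidean]
  intro i
  rw [hasFDerivWithinAt_univ]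
  fin_cases i
  · refine (hx1.mul hs).neg.congr_fderiv ?_
    ext <;> simp [mul_comm]
  · refine (hx1.mul hc).congr_fderiv ?_
    ext <;> simp [mul_comm]
  · refine (hasFDerivAt_const (0 : ℝ) p).congr_fderiv ?_
    ext <;> simp
  · refine (hasFDerivAt_const (0 : ℝ) p).congr_fderiv ?_
    ext <;> simp

theorem contDiff_rotSurface {x y z : ℝ → ℝ} (hx : ContDiff ℝ (⊤ : ℕ∞) x)
    (hy : ContDiff ℝ (⊤ : ℕ∞) y) (hz : ContDiff ℝ (⊤ : ℕ∞) z) :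
    ContDiff ℝ (⊤ : ℕ∞) (rotSurface x y z) := by
  rw [contDiff_euclidean]
  intro i
  fin_cases i
  · exact (hx.comp contDiff_fst).mul (Real.contDiff_cos.comp contDiff_snd)
  · exact (hx.comp contDiff_fst).mul (Real.contDiff_sin.comp contDiff_snd)
  · exact hy.comp contDiff_fst
  · exact hz.comp contDiff_fst

theorem ContDiff.hasDerivAt_of_smooth {f : ℝ → ℝ} (hf : ContDiff ℝ (⊤ : ℕ∞) f) (s : ℝ) :
    HasDerivAt f (deriv f s) s :=
  (hf.differentiable (by simp) s).hasDerivAt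

theorem ContDiff.deriv_smooth {f : ℝ → ℝ} (hf : ContDiff ℝ (⊤ : ℕ∞) f) :
    ContDiff ℝ (⊤ : ℕ∞) (deriv f) :=
  (contDiff_infty_iff_deriv.1 hf).2

theorem E4.inner_eq (u v : E4) :
    inner ℝ u v = u 0 * v 0 + u 1 * v 1 + u 2 * v 2 + u 3 * v 3 := by
  simp [PiLp.inner_apply, Fin.sum_univ_four, mul_comm]

namespace IsProfileCurve

variable {x y z : ℝ → ℝ}

theorem fderiv_rotSurface (h : IsProfileCurve x y z) (p v : ℝ × ℝ) :
    fderiv ℝ (rotSurface x y z) p v =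
      v.1 • rotSurface (deriv x) (deriv y) (deriv z) p + v.2 • rotParallel x p := by
  rw [(hasFDerivAt_rotSurface (h.smooth_x.hasDerivAt_of_smooth p.1)
    (h.smooth_y.hasDerivAt_of_smooth p.1) (h.smooth_z.hasDerivAt_of_smooth p.1)).fderiv]
  rfl

theorem fderiv_fderiv_rotSurface (h : IsProfileCurve x y z) (p v w : ℝ × ℝ) :
    fderiv ℝ (fderiv ℝ (rotSurface x y z)) p v w =
      (v.1 * w.1) • rotSurface (deriv (deriv x)) (deriv (deriv y)) (deriv (deriv z)) p +
      (v.2 * w.1 + v.1 * w.2) • rotParallel (deriv x) p -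
      (v.2 * w.2) • rotSurface x 0 0 p := by
  have hψ := contDiff_rotSurface h.smooth_x h.smooth_y h.smooth_z
  have hd : DifferentiableAt ℝ (fderiv ℝ (rotSurface x y z)) p :=
    ((hψ.fderiv_right (m := 1) (by exact WithTop.coe_le_coe.2 le_top)).differentiable one_ne_zero) p
  have h1 : fderiv ℝ (fderiv ℝ (rotSurface x y z)) p v w =
      fderiv ℝ (fun q => fderiv ℝ (rotSurface x y z) q w) p v := by
    rw [fderiv_clm_apply hd (differentiableAt_const w)]
    simp
  rw [h1]
  simp_rw [h.fderiv_rotSurface]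
  have hA := hasFDerivAt_rotSurface (h.smooth_x.deriv_smooth.hasDerivAt_of_smooth p.1)
    (h.smooth_y.deriv_smooth.hasDerivAt_of_smooth p.1)
    (h.smooth_z.deriv_smooth.hasDerivAt_of_smooth p.1)
  have hB := hasFDerivAt_rotParallel (h.smooth_x.hasDerivAt_of_smooth p.1)
  have hAB : fderiv ℝ (fun q => w.1 • rotSurface (deriv x) (deriv y) (deriv z) q +
      w.2 • rotParallel x q) p = _ := ((hA.const_smul w.1).add (hB.const_smul w.2)).fderiv
  rw [hAB]
  ext i
  fin_cases i <;> simp [rotSurface, rotParallel] <;> ring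

theorem sphere_deriv (h : IsProfileCurve x y z) (s : ℝ) :
    x s * deriv x s + y s * deriv y s + z s * deriv z s = 0 := by
  have h1 := (((h.smooth_x.hasDerivAt_of_smooth s).pow 2).add
    ((h.smooth_y.hasDerivAt_of_smooth s).pow 2)).add ((h.smooth_z.hasDerivAt_of_smooth s).pow 2)
  have h2 : (x ^ 2 + y ^ 2 + z ^ 2) = fun _ => (1 : ℝ) := funext h.sphere
  rw [h2] at h1
  have := h1.unique (hasDerivAt_const s 1)
  norm_num at this
  linarith

theorem unit_speed_deriv (h : IsProfileCurve x y z) (s : ℝ) :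
    deriv x s * deriv (deriv x) s + deriv y s * deriv (deriv y) s
      + deriv z s * deriv (deriv z) s = 0 := by
  have h1 := (((h.smooth_x.deriv_smooth.hasDerivAt_of_smooth s).pow 2).add
    ((h.smooth_y.deriv_smooth.hasDerivAt_of_smooth s).pow 2)).add
      ((h.smooth_z.deriv_smooth.hasDerivAt_of_smooth s).pow 2)
  have h2 : (deriv x ^ 2 + deriv y ^ 2 + deriv z ^ 2) = fun _ => (1 : ℝ) := funext h.unit_speed
  rw [h2] at h1
  have := h1.unique (hasDerivAt_const s 1)
  norm_num at this
  linarith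

theorem sphere_deriv_deriv (h : IsProfileCurve x y z) (s : ℝ) :
    x s * deriv (deriv x) s + y s * deriv (deriv y) s + z s * deriv (deriv z) s = -1 := by
  have h1 := (((h.smooth_x.hasDerivAt_of_smooth s).mul
    (h.smooth_x.deriv_smooth.hasDerivAt_of_smooth s)).add
    ((h.smooth_y.hasDerivAt_of_smooth s).mul
    (h.smooth_y.deriv_smooth.hasDerivAt_of_smooth s))).add
    ((h.smooth_z.hasDerivAt_of_smooth s).mul
    (h.smooth_z.deriv_smooth.hasDerivAt_of_smooth s))
  have h2 : (x * deriv x + y * deriv y + z * deriv z) = fun _ => (0 : ℝ) := funext h.sphere_deriv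
  rw [h2] at h1
  have := h1.unique (hasDerivAt_const s 0)
  have := h.unit_speed s
  linarith

/-- Lagrange's identity in the `(y, z)`-plane; in particular the radicand in the level equation is
nonnegative. -/
theorem wronskian_sq (h : IsProfileCurve x y z) (s : ℝ) :
    (y s * deriv z s - z s * deriv y s) ^ 2 = 1 - x s ^ 2 - deriv x s ^ 2 := by
  have h1 := h.sphere s
  have h2 := h.sphere_deriv s
  have h3 := h.unit_speed s
  have e1 : y s ^ 2 + z s ^ 2 = 1 - x s ^ 2 := by linarith
  have e2 : deriv y s ^ 2 + deriv z s ^ 2 = 1 - deriv x s ^ 2 := by linarith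
  have e3 : y s * deriv y s + z s * deriv z s = - (x s * deriv x s) := by linarith
  calc _ = (y s ^ 2 + z s ^ 2) * (deriv y s ^ 2 + deriv z s ^ 2)
      - (y s * deriv y s + z s * deriv z s) ^ 2 := by ring
    _ = _ := by rw [e1, e2, e3]; ring

theorem firstForm_rotSurface (h : IsProfileCurve x y z) (p v w : ℝ × ℝ) :
    firstForm (rotSurface x y z) p v w = v.1 * w.1 + x p.1 ^ 2 * (v.2 * w.2) := by
  rw [firstForm, h.fderiv_rotSurface, h.fderiv_rotSurface, E4.inner_eq]
  simp only [rotSurface, rotParallel, PiLp.add_apply, PiLp.smul_apply, smul_eq_mul,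
    Matrix.cons_val]
  linear_combination (v.1 * w.1) * h.unit_speed p.1 +
    (v.1 * w.1 * deriv x p.1 ^ 2 + x p.1 ^ 2 * (v.2 * w.2)) * Real.sin_sq_add_cos_sq p.2

/-- Only `r ^ 2` and `r * l` are pinned down, so the result holds for either choice of unit normal.
`r` is the radial component of `N`. -/
theorem secondForm_rotSurface (h : IsProfileCurve x y z) {N : ℝ × ℝ → E4} (hN : IsUnitNormal (rotSurface x y z) N)
    (p : ℝ × ℝ) (hx : x p.1 ≠ 0) :
    ∃ r l : ℝ, r = Real.cos p.2 * N p 0 + Real.sin p.2 * N p 1 ∧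
      r ^ 2 = 1 - x p.1 ^ 2 - deriv x p.1 ^ 2 ∧ r * l = deriv (deriv x) p.1 + x p.1 ∧
      ∀ v w, secondForm (rotSurface x y z) N p v w = l * (v.1 * w.1) - x p.1 * r * (v.2 * w.2) := by
  have h0 := hN.tangent_sphere p
  have h1 := hN.normal p (1, 0)
  have h2 := hN.normal p (0, 1)
  have h3 : inner ℝ (N p) (N p) = 1 := by
    rw [real_inner_self_eq_norm_sq, hN.unit, one_pow]
  rw [h.fderiv_rotSurface, E4.inner_eq] at h1 h2
  rw [E4.inner_eq] at h0 h3
  simp only [rotSurface, rotParallel, PiLp.add_apply, PiLp.smul_apply, smul_eq_mul,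
    Matrix.cons_val] at h0 h1 h2
  have hsc := Real.sin_sq_add_cos_sq p.2
  set S := Real.sin p.2
  set C := Real.cos p.2
  obtain ⟨r, hr⟩ : ∃ r, r = C * N p 0 + S * N p 1 := ⟨_, rfl⟩
  -- Orthogonality to the parallel, where `x ≠ 0` is needed; the first two coordinates of `N` are
  -- therefore purely radial.
  have hB : -(S * N p 0) + C * N p 1 = 0 := by
    apply mul_left_cancel₀ hx
    linarith
  have hN0 : N p 0 = r * C := by
    rw [hr]; linear_combination (-N p 0) * hsc - S * hB
  have hN1 : N p 1 = r * S := by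
    rw [hr]; linear_combination (-N p 1) * hsc + C * hB
  have g0 : r * x p.1 + N p 2 * y p.1 + N p 3 * z p.1 = 0 := by
    rw [hN0, hN1] at h0
    linear_combination h0 - r * x p.1 * hsc
  have g1 : r * deriv x p.1 + N p 2 * deriv y p.1 + N p 3 * deriv z p.1 = 0 := by
    rw [hN0, hN1] at h1
    linear_combination h1 - r * deriv x p.1 * hsc
  have g2 : r ^ 2 + N p 2 ^ 2 + N p 3 ^ 2 = 1 := by
    rw [hN0, hN1] at h3
    linear_combination h3 - r ^ 2 * hsc
  have s1 := h.sphere p.1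
  have s2 := h.unit_speed p.1
  have s3 := h.sphere_deriv p.1
  have s4 := h.sphere_deriv_deriv p.1
  have s5 := h.unit_speed_deriv p.1
  -- The profile point, its velocity and the reduced normal form an orthonormal frame of `ℝ³`.
  -- Orthonormality of the columns gives both relations for `r`.
  let M : Matrix (Fin 3) (Fin 3) ℝ :=
    !![x p.1, y p.1, z p.1; deriv x p.1, deriv y p.1, deriv z p.1; r, N p 2, N p 3]
  have hM : M * M.transpose = 1 := by
    ext i j
    fin_cases i <;> fin_cases j <;>
      simp [M, Matrix.mul_apply, Fin.sum_univ_three] <;> linarith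
  have hM' : M.transpose * M = 1 := mul_eq_one_comm.1 hM
  have m0 := congrFun (congrFun hM' 0) 0
  have m1 := congrFun (congrFun hM' 0) 1
  have m2 := congrFun (congrFun hM' 0) 2
  simp [M, Matrix.mul_apply, Fin.sum_univ_three] at m0 m1 m2
  refine ⟨r, r * deriv (deriv x) p.1 + N p 2 * deriv (deriv y) p.1 + N p 3 * deriv (deriv z) p.1,
    hr, by linarith, ?_, fun v w => ?_⟩
  · linear_combination deriv (deriv x) p.1 * m0 + deriv (deriv y) p.1 * m1 +
      deriv (deriv z) p.1 * m2 - x p.1 * s4 - deriv x p.1 * s5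
  · rw [secondForm, h.fderiv_fderiv_rotSurface, E4.inner_eq, hN0, hN1]
    simp only [rotSurface, rotParallel, PiLp.add_apply, PiLp.sub_apply, PiLp.smul_apply,
      smul_eq_mul, Matrix.cons_val, Pi.zero_apply]
    linear_combination (v.1 * w.1 * r * deriv (deriv x) p.1 - x p.1 * r * (v.2 * w.2)) * hsc

theorem meanCurv_gaussCurv (h : IsProfileCurve x y z) {N : ℝ × ℝ → E4} {p : ℝ × ℝ} {r l : ℝ}
    (hx : x p.1 ≠ 0) (hN : ∀ v w, secondForm (rotSurface x y z) N p v w =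
      l * (v.1 * w.1) - x p.1 * r * (v.2 * w.2)) :
    meanCurv (rotSurface x y z) N p = (l - r / x p.1) / 2 ∧
      gaussCurv (rotSurface x y z) N p = -(l * r / x p.1) := by
  simp only [meanCurv, gaussCurv, areaSq, hN, h.firstForm_rotSurface, mul_one, mul_zero,
    add_zero, zero_add, sub_zero, zero_sub, one_mul]
  constructor <;> field_simp <;> ring

end IsProfileCurve

/-! ### Completeness: comparison of the induced metric with the sup norm on `ℝ × ℝ`. -/

theorem norm_prod_le_sqrt {c u : ℝ} (hc : 0 ≤ c) (hc1 : c ≤ 1) (hcu : c ≤ u) (v : ℝ × ℝ) :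
    c * ‖v‖ ≤ √(v.1 * v.1 + u ^ 2 * (v.2 * v.2)) := by
  apply Real.le_sqrt_of_sq_le
  have hu : c ^ 2 ≤ u ^ 2 := pow_le_pow_left₀ hc hcu 2
  have hc2 : c ^ 2 ≤ 1 := pow_le_one₀ hc hc1
  rw [Prod.norm_def, mul_pow]
  rcases max_choice ‖v.1‖ ‖v.2‖ with h | h <;> rw [h, Real.norm_eq_abs, sq_abs]
  · nlinarith [mul_le_mul_of_nonneg_right hc2 (sq_nonneg v.1),
      mul_nonneg (sq_nonneg u) (sq_nonneg v.2)]
  · nlinarith [mul_le_mul_of_nonneg_right hu (sq_nonneg v.2), sq_nonneg v.1]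

theorem sqrt_le_two_mul_norm {u : ℝ} (hu : 0 ≤ u) (hu1 : u ≤ 1) (v : ℝ × ℝ) :
    √(v.1 * v.1 + u ^ 2 * (v.2 * v.2)) ≤ 2 * ‖v‖ := by
  apply Real.sqrt_le_iff.2 ⟨by positivity, ?_⟩
  have h1 : v.1 ^ 2 ≤ ‖v‖ ^ 2 := by
    rw [← sq_abs]; exact pow_le_pow_left₀ (abs_nonneg _) (norm_fst_le v) 2
  have h2 : v.2 ^ 2 ≤ ‖v‖ ^ 2 := by
    rw [← sq_abs]; exact pow_le_pow_left₀ (abs_nonneg _) (norm_snd_le v) 2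
  have hu2 : u ^ 2 ≤ 1 := pow_le_one₀ hu hu1
  nlinarith [mul_le_mul_of_nonneg_right hu2 (sq_nonneg v.2), sq_nonneg ‖v‖]

namespace IsProfileCurve

variable {x y z : ℝ → ℝ}

theorem le_one (h : IsProfileCurve x y z) (s : ℝ) : x s ≤ 1 := by
  nlinarith [h.sphere s, sq_nonneg (y s), sq_nonneg (z s), h.nonneg s]

theorem le_inducedLength (h : IsProfileCurve x y z) {c : ℝ} (hc : 0 ≤ c) (hcx : ∀ s, c ≤ x s)
    {σ : ℝ → ℝ × ℝ} (hσ : ContDiff ℝ 1 σ) :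
    c * ‖σ 0 - σ 1‖ ≤ inducedLength (rotSurface x y z) σ := by
  have hdσ : Continuous (deriv σ) := hσ.continuous_deriv le_rfl
  have hint : ∫ t in (0 : ℝ)..1, deriv σ t = σ 1 - σ 0 :=
    intervalIntegral.integral_deriv_eq_sub
      (fun t _ => hσ.differentiable one_ne_zero t) (hdσ.intervalIntegrable _ _)
  have hxσ : Continuous fun t => x (σ t).1 :=
    h.smooth_x.continuous.comp (continuous_fst.comp hσ.continuous)
  rw [norm_sub_rev, ← hint, inducedLength]
  simp_rw [h.firstForm_rotSurface]
  calc c * ‖∫ t in (0 : ℝ)..1, deriv σ t‖ ≤ c * ∫ t in (0 : ℝ)..1, ‖deriv σ t‖ :=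
        mul_le_mul_of_nonneg_left (intervalIntegral.norm_integral_le_integral_norm zero_le_one) hc
    _ = ∫ t in (0 : ℝ)..1, c * ‖deriv σ t‖ := (intervalIntegral.integral_const_mul _ _).symm
    _ ≤ _ := by
      apply intervalIntegral.integral_mono_on zero_le_one
      · exact (continuous_const.mul hdσ.norm).intervalIntegrable _ _
      · have h1 := continuous_fst.comp hdσ
        have h2 := continuous_snd.comp hdσ
        exact ((h1.mul h1).add ((hxσ.pow 2).mul (h2.mul h2))).sqrt.intervalIntegrable _ _
      · exact fun t _ => norm_prod_le_sqrt hc ((hcx 0).trans (h.le_one 0)) (hcx _) _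

theorem bddBelow_lengths (p q : ℝ × ℝ) :
    BddBelow {l | ∃ σ : ℝ → ℝ × ℝ, ContDiff ℝ 1 σ ∧ σ 0 = p ∧ σ 1 = q ∧
      l = inducedLength (rotSurface x y z) σ} := by
  refine ⟨0, ?_⟩
  rintro l ⟨σ, -, -, -, rfl⟩
  exact intervalIntegral.integral_nonneg zero_le_one fun t _ => Real.sqrt_nonneg _

theorem inducedLength_segment_le (h : IsProfileCurve x y z) (p q : ℝ × ℝ) :
    inducedLength (rotSurface x y z) (fun t => p + t • (q - p)) ≤ 2 * ‖p - q‖ := by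
  have hd : ∀ t : ℝ, deriv (fun t : ℝ => p + t • (q - p)) t = q - p := fun t => by
    simpa using (((hasDerivAt_id t).smul_const (q - p)).const_add p).deriv
  have hx := h.smooth_x.continuous
  rw [inducedLength]
  simp_rw [hd, h.firstForm_rotSurface]
  calc _ ≤ ∫ t in (0 : ℝ)..1, 2 * ‖q - p‖ := by
        apply intervalIntegral.integral_mono_on zero_le_one
        · exact Continuous.intervalIntegrable (by fun_prop) _ _
        · exact continuous_const.intervalIntegrable _ _
        · exact fun t _ => sqrt_le_two_mul_norm (h.nonneg _) (h.le_one _) _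
    _ = 2 * ‖p - q‖ := by rw [norm_sub_rev]; simp

theorem inducedDist_le (h : IsProfileCurve x y z) (p q : ℝ × ℝ) :
    inducedDist (rotSurface x y z) p q ≤ 2 * ‖p - q‖ :=
  (csInf_le (bddBelow_lengths p q)
    ⟨fun t => p + t • (q - p), by fun_prop, by simp, by simp, rfl⟩).trans
    (h.inducedLength_segment_le p q)

theorem le_inducedDist (h : IsProfileCurve x y z) {c : ℝ} (hc : 0 ≤ c) (hcx : ∀ s, c ≤ x s)
    (p q : ℝ × ℝ) : c * ‖p - q‖ ≤ inducedDist (rotSurface x y z) p q := by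
  apply le_csInf
  · exact ⟨_, fun t => p + t • (q - p), by fun_prop, by simp, by simp, rfl⟩
  · rintro l ⟨σ, hσ, rfl, rfl, rfl⟩
    exact h.le_inducedLength hc hcx hσ

/-- The induced distance lies between `c` and `2` times the norm distance, so Cauchy sequences and
limits are those of the plane. -/
theorem isInducedComplete (h : IsProfileCurve x y z) {c : ℝ} (hc : 0 < c)
    (hcx : ∀ s, c ≤ x s) : IsInducedComplete (rotSurface x y z) := by
  intro u hu
  have hcau : CauchySeq u := by
    rw [Metric.cauchySeq_iff]
    intro ε hε
    obtain ⟨n₀, hn⟩ := hu (c * ε) (mul_pos hc hε)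
    refine ⟨n₀, fun m hm n hn' => ?_⟩
    rw [dist_eq_norm]
    exact lt_of_mul_lt_mul_left ((h.le_inducedDist hc.le hcx _ _).trans_lt (hn m hm n hn')) hc.le
  obtain ⟨p, hp⟩ := cauchySeq_tendsto_of_complete hcau
  refine ⟨p, squeeze_zero (fun n => ?_) (fun n => h.inducedDist_le (u n) p) ?_⟩
  · exact (mul_nonneg hc.le (norm_nonneg _)).trans (h.le_inducedDist hc.le hcx _ _)
  · simpa using (tendsto_iff_norm_sub_tendsto_zero.1 hp).const_mul 2

theorem isSphereImmersion (h : IsProfileCurve x y z) (hx : ∀ s, 0 < x s) :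
    IsSphereImmersion (rotSurface x y z) where
  smooth := contDiff_rotSurface h.smooth_x h.smooth_y h.smooth_z
  sphere p := by
    have : ‖rotSurface x y z p‖ ^ 2 = 1 := by
      rw [← real_inner_self_eq_norm_sq, E4.inner_eq]
      simp only [rotSurface, Matrix.cons_val]
      linear_combination h.sphere p.1 + x p.1 ^ 2 * Real.sin_sq_add_cos_sq p.2
    exact (pow_eq_one_iff_of_nonneg (norm_nonneg _) two_ne_zero).1 this
  immersion p := by
    rw [injective_iff_map_eq_zero]
    intro v hv
    have h1 := h.firstForm_rotSurface p v v
    rw [firstForm, hv, inner_zero_left] at h1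
    have hx2 : 0 < x p.1 ^ 2 := pow_pos (hx _) 2
    have hv1 : v.1 = 0 := by
      nlinarith [mul_nonneg hx2.le (mul_self_nonneg v.2), mul_self_nonneg v.1]
    have hv2 : v.2 = 0 := by
      rw [hv1] at h1
      simpa [hx2.ne', (hx p.1).ne'] using h1
    exact Prod.ext hv1 hv2

end IsProfileCurve

/-! ### Consequences of the level equation: lower bounds and non-isoparametricity. -/

theorem IsPreconnected.eq_of_forall_mem_finite {f : ℝ → ℝ} (hf : Continuous f) {s : Set ℝ}
    (hs : s.Finite) (h : ∀ t, f t ∈ s) (t u : ℝ) : f t = f u :=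
  hs.countable.isTotallyDisconnected (range f) (range_subset_iff.2 h)
    (isPreconnected_range hf) (mem_range_self t) (mem_range_self u)

/-- The values `α` in the interval of the family satisfy `(4α - b)² < a² + b²`. -/
theorem sq_lt_of_mem_Ioo {a b α : ℝ} (hα : α ∈ Ioo (max 0 (b / 2)) (alphaZero a b 0)) :
    (4 * α - b) ^ 2 < a ^ 2 + b ^ 2 := by
  obtain ⟨h0, h1⟩ := hα
  obtain ⟨h2, h3⟩ := max_lt_iff.1 h0
  simp only [alphaZero, add_zero] at h1
  have hb : |b| ≤ √(a ^ 2 + b ^ 2) := Real.abs_le_sqrt (by nlinarith [sq_nonneg a])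
  have hb' := abs_le.1 hb
  have : |4 * α - b| < √(a ^ 2 + b ^ 2) := abs_lt.2 ⟨by linarith, by linarith⟩
  have h4 := pow_lt_pow_left₀ this (abs_nonneg _) two_ne_zero
  rwa [sq_abs, Real.sq_sqrt (by positivity)] at h4

namespace IsRLWS

variable {a b c α : ℝ} {x y z : ℝ → ℝ} {N : ℝ × ℝ → E4}

theorem exists_le_of_level (h : IsRLWS a b 0 α x y z N) (ha : 0 < a) (hα : max 0 (b / 2) < α) :
    ∃ c > 0, ∀ s, c ≤ x s ∧ c ≤ √(1 - x s ^ 2 - deriv x s ^ 2) := by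
  obtain ⟨h0, h1⟩ := max_lt_iff.1 hα
  -- `a/2 · x k = α - b/2 · g` is affine in `g = x² + ẋ² ∈ [0, 1]`, so its minimum is at an
  -- endpoint. Since `x, k ≤ 1`, a lower bound for `x k` bounds each factor.
  obtain ⟨m, hm, hm1, hm2⟩ : ∃ m : ℝ, 0 < m ∧ m ≤ α ∧ m ≤ α - b / 2 :=
    ⟨min α (α - b / 2), lt_min h0 (by linarith), min_le_left _ _, min_le_right _ _⟩
  refine ⟨m / (a / 2), by positivity, fun s => ?_⟩
  have hl := h.level s
  have hw : 0 ≤ 1 - x s ^ 2 - deriv x s ^ 2 := by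
    rw [← h.profile.wronskian_sq]; positivity
  have hx0 := h.profile.nonneg s
  have hx1 := h.profile.le_one s
  set k := √(1 - x s ^ 2 - deriv x s ^ 2)
  have hk0 : 0 ≤ k := Real.sqrt_nonneg _
  have hk1 : k ≤ 1 := by
    exact Real.sqrt_le_iff.2 ⟨zero_le_one, by nlinarith [sq_nonneg (x s), sq_nonneg (deriv x s)]⟩
  have hg0 : 0 ≤ x s ^ 2 + deriv x s ^ 2 := by positivity
  have key : m ≤ a / 2 * (x s * k) := by
    rcases le_total 0 b with hb | hb
    · nlinarith
    · nlinarith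
  have : m / (a / 2) ≤ x s * k := by
    rw [div_le_iff₀ (by positivity)]; linarith
  constructor <;> nlinarith

theorem not_isIsoparametric (h : IsRLWS a b 0 α x y z N) (ha : 0 < a)
    (hα : α ∈ Ioo (max 0 (b / 2)) (alphaZero a b 0)) : ¬ IsIsoparametric (rotSurface x y z) := by
  rintro ⟨N', hN', k₁, k₂, hk⟩
  obtain ⟨c, hc, hcx⟩ := h.exists_le_of_level ha hα.1
  have hx : ∀ s, 0 < x s := fun s => hc.trans_le (hcx s).1
  have hh : ∀ s, 0 < √(1 - x s ^ 2 - deriv x s ^ 2) := fun s => hc.trans_le (hcx s).2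
  have hh2 : ∀ s, 0 < 1 - x s ^ 2 - deriv x s ^ 2 := fun s => Real.sqrt_pos.1 (hh s)
  have hcont : Continuous fun s => (1 - x s ^ 2 - deriv x s ^ 2) / x s ^ 2 := by
    have h1 := h.profile.smooth_x.continuous
    have h2 := h.profile.smooth_x.deriv_smooth.continuous
    exact ((continuous_const.sub (h1.pow 2)).sub (h2.pow 2)).div (h1.pow 2)
      fun s => (pow_pos (hx s) 2).ne'
  -- Squaring removes the unknown sign of `N'`. The curvature might still switch between the two
  -- values; continuity excludes that.
  have hmem : ∀ s, (1 - x s ^ 2 - deriv x s ^ 2) / x s ^ 2 ∈ ({k₁ ^ 2, k₂ ^ 2} : Set ℝ) := by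
    intro s
    obtain ⟨r, l, -, hr2, -, hsf⟩ := h.profile.secondForm_rotSurface hN' (s, 0) (hx s).ne'
    have hp : IsPrincipalCurvature (rotSurface x y z) N' (s, 0) (-r / x s) := by
      refine ⟨(0, 1), by simp, fun w => ?_⟩
      rw [hsf, h.profile.firstForm_rotSurface]
      have := (hx s).ne'
      field_simp
      ring
    have hp' : -r / x s ∈ ({k₁, k₂} : Set ℝ) := by rw [← hk (s, 0)]; exact hp
    have e : (1 - x s ^ 2 - deriv x s ^ 2) / x s ^ 2 = (-r / x s) ^ 2 := by
      rw [← hr2, div_pow, neg_sq]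
    rw [e]
    rcases hp' with hp' | hp'
    · left; rw [hp']
    · right; rw [mem_singleton_iff.1 hp']; rfl
  have hconst := IsPreconnected.eq_of_forall_mem_finite hcont (toFinite _) hmem
  obtain ⟨m, hm⟩ : ∃ m, m = √((1 - x 0 ^ 2 - deriv x 0 ^ 2) / x 0 ^ 2) := ⟨_, rfl⟩
  have hhm : ∀ s, √(1 - x s ^ 2 - deriv x s ^ 2) = m * x s := by
    intro s
    rw [hm, hconst 0 s, Real.sqrt_div (hh2 s).le, Real.sqrt_sq (hx s).le,
      div_mul_cancel₀ _ (hx s).ne']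
  have hsq : ∀ s, 1 - x s ^ 2 - deriv x s ^ 2 = (m * x s) ^ 2 := by
    intro s
    rw [← hhm s, Real.sq_sqrt (hh2 s).le]
  have hlev : ∀ s, (a * m - b * m ^ 2) * x s ^ 2 = 2 * α - b := by
    intro s
    have h1 := h.level s
    rw [hhm s] at h1
    linear_combination 2 * h1 + b * hsq s
  have hβ : 0 < 2 * α - b := by linarith [(max_lt_iff.1 hα.1).2]
  have hcoef : a * m - b * m ^ 2 ≠ 0 := by
    intro h0
    have := hlev 0
    rw [h0, zero_mul] at this
    exact hβ.ne this
  have hxc : x = fun _ => x 0 := by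
    funext s
    have h1 : x s ^ 2 = x 0 ^ 2 := mul_left_cancel₀ hcoef ((hlev s).trans (hlev 0).symm)
    exact (pow_left_inj₀ (hx s).le (hx 0).le two_ne_zero).1 h1
  have hd : deriv x = fun _ => 0 := by rw [hxc]; simp
  have hdd : deriv (deriv x) 0 = 0 := by rw [hd]; simp
  have hd0 : deriv x 0 = 0 := by rw [hd]
  -- Back to the given normal `N`: the Weingarten equation depends on its orientation, and `outward`
  -- gives `r ≥ 0`.
  obtain ⟨r, l, hr, hr2, hrl, hsf⟩ := h.profile.secondForm_rotSurface h.normal (0, 0) (hx 0).ne'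
  have hr0 : 0 ≤ r := hr ▸ h.outward (0, 0)
  have hL := h.level 0
  have hW := h.weingarten (0, 0)
  simp only [hd0, hdd] at hr2 hrl hL
  obtain ⟨hH, hK⟩ := h.profile.meanCurv_gaussCurv (hx 0).ne' hsf
  rw [hH, hK] at hW
  have hrr : √(1 - x 0 ^ 2 - 0 ^ 2) = r := by rw [← hr2, Real.sqrt_sq hr0]
  have hrpos : 0 < r := by rw [← hrr]; simpa [hd0] using hh 0
  rw [hrr] at hL
  have hx0 := (hx 0).ne'
  have hl : l = x 0 / r := by
    rw [eq_div_iff hrpos.ne', mul_comm]; linarith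
  rw [hl] at hW
  field_simp at hW
  have hW' : a * (x 0 ^ 2 - r ^ 2) = b * (2 * x 0 * r) := by
    nlinarith [hW]
  have hlt := sq_lt_of_mem_Ioo hα
  -- `(2xr, x² - r²)` is a unit vector. Its inner product with `(a, b)` is `4α - b`, and `hW'` makes
  -- it parallel to `(a, b)`.
  have h4 : 4 * α - b = a * (2 * x 0 * r) + b * (x 0 ^ 2 - r ^ 2) := by
    linear_combination (-4) * hL + b * hr2
  have hSD : (2 * x 0 * r) ^ 2 + (x 0 ^ 2 - r ^ 2) ^ 2 = 1 := by
    have h5 : x 0 ^ 2 + r ^ 2 = 1 := by linarith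
    linear_combination (x 0 ^ 2 + r ^ 2 + 1) * h5
  have : (4 * α - b) ^ 2 = a ^ 2 + b ^ 2 := by
    rw [h4]
    linear_combination (a ^ 2 + b ^ 2) * hSD -
      (a * (x 0 ^ 2 - r ^ 2) - b * (2 * x 0 * r)) * hW'
  exact hlt.ne this

end IsRLWS

/-! ### Construction of the surface from the pair `(x, k)`. -/

theorem exists_smooth_primitive {f : ℝ → ℝ} (hf : ContDiff ℝ (⊤ : ℕ∞) f) :
    ∃ F : ℝ → ℝ, ContDiff ℝ (⊤ : ℕ∞) F ∧ ∀ t, HasDerivAt F (f t) t := by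
  have hd : ∀ t, HasDerivAt (fun t => ∫ s in (0 : ℝ)..t, f s) (f t) t := fun t =>
    intervalIntegral.integral_hasDerivAt_right (hf.continuous.intervalIntegrable _ _)
      hf.continuous.stronglyMeasurable.stronglyMeasurableAtFilter hf.continuous.continuousAt
  refine ⟨_, contDiff_infty_iff_deriv.2 ⟨fun t => (hd t).differentiableAt, ?_⟩, hd⟩
  rw [funext fun t => (hd t).deriv]
  exact hf

/-- The scalar autonomous equation `θ' = 1 / f(θ)` has a global smooth solution if `f` is
bounded below by a positive constant. -/
theorem exists_smooth_autonomous_solution {f : ℝ → ℝ} (hf : ContDiff ℝ (⊤ : ℕ∞) f) {δ : ℝ}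
    (hδ : 0 < δ) (hfδ : ∀ t, δ ≤ f t) :
    ∃ θ : ℝ → ℝ, ContDiff ℝ (⊤ : ℕ∞) θ ∧ ∀ s, HasDerivAt θ (f (θ s))⁻¹ s := by
  obtain ⟨G, hG, hd⟩ := exists_smooth_primitive hf
  have hpos : ∀ t, 0 < f t := fun t => hδ.trans_le (hfδ t)
  have hmono : StrictMono G := strictMono_of_deriv_pos fun t => by rw [(hd t).deriv]; exact hpos t
  have hgrow : Monotone fun t => G t - δ * t := by
    apply monotone_of_deriv_nonneg
    · exact (hG.differentiable (by simp)).sub (differentiable_id.const_mul δ)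
    · intro t
      have h1 : HasDerivAt (fun t => G t - δ * t) (f t - δ * 1) t :=
        (hd t).sub ((hasDerivAt_id t).const_mul δ)
      rw [h1.deriv]
      linarith [hfδ t]
  have htop : Tendsto G atTop atTop := by
    have h1 : Tendsto (fun t => G 0 + δ * t) atTop atTop :=
      tendsto_atTop_add_const_left _ _ (tendsto_id.const_mul_atTop hδ)
    refine tendsto_atTop_mono' _ ?_ h1
    filter_upwards [eventually_ge_atTop 0] with t ht
    have := hgrow ht
    simp only at this
    linarith
  have hbot : Tendsto G atBot atBot := by
    have h1 : Tendsto (fun t => G 0 + δ * t) atBot atBot :=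
      tendsto_atBot_add_const_left _ _ (tendsto_id.const_mul_atBot hδ)
    refine tendsto_atBot_mono' _ ?_ h1
    filter_upwards [eventually_le_atBot 0] with t ht
    have := hgrow ht
    simp only at this
    linarith
  -- Separation of variables: `G' = f`, so the solution is the inverse of `G`. The bound `δ` makes
  -- `G` onto, hence the solution global.
  let e := (hmono.orderIsoOfSurjective G (hG.continuous.surjective htop hbot)).toHomeomorph
  have he : ⇑e = G := rfl
  refine ⟨e.symm, e.contDiff_symm_deriv (f' := f) (fun t => (hpos t).ne') hd hG, fun s => ?_⟩
  exact (hd (e.symm s)).of_local_left_inverse e.symm.continuous.continuousAt (hpos _).ne'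
    (Eventually.of_forall e.apply_symm_apply)

/-- The unit normal of a rotational surface given by the cross product of the profile curve with
its derivative. -/
noncomputable def profileNormal (x y z : ℝ → ℝ) : ℝ × ℝ → E4 :=
  rotSurface (fun s => y s * deriv z s - z s * deriv y s)
    (fun s => z s * deriv x s - x s * deriv z s) (fun s => x s * deriv y s - y s * deriv x s)

theorem IsProfileCurve.isUnitNormal_profileNormal {x y z : ℝ → ℝ} (h : IsProfileCurve x y z) :
    IsUnitNormal (rotSurface x y z) (profileNormal x y z) where
  smooth := by
    have hx := h.smooth_x
    have hy := h.smooth_y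
    have hz := h.smooth_z
    have hx' := hx.deriv_smooth
    have hy' := hy.deriv_smooth
    have hz' := hz.deriv_smooth
    exact contDiff_rotSurface ((hy.mul hz').sub (hz.mul hy')) ((hz.mul hx').sub (hx.mul hz'))
      ((hx.mul hy').sub (hy.mul hx'))
  unit p := by
    have : ‖profileNormal x y z p‖ ^ 2 = 1 := by
      rw [← real_inner_self_eq_norm_sq, E4.inner_eq]
      simp only [profileNormal, rotSurface, Matrix.cons_val]
      have h1 := h.sphere p.1
      have h2 := h.unit_speed p.1
      have h3 := h.sphere_deriv p.1
      linear_combination (y p.1 * deriv z p.1 - z p.1 * deriv y p.1) ^ 2 *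
        Real.sin_sq_add_cos_sq p.2 + (deriv x p.1 ^ 2 + deriv y p.1 ^ 2 + deriv z p.1 ^ 2) * h1
        + h2 - (x p.1 * deriv x p.1 + y p.1 * deriv y p.1 + z p.1 * deriv z p.1) * h3
    exact (pow_eq_one_iff_of_nonneg (norm_nonneg _) two_ne_zero).1 this
  tangent_sphere p := by
    rw [E4.inner_eq]
    simp only [profileNormal, rotSurface, Matrix.cons_val]
    linear_combination (y p.1 * deriv z p.1 - z p.1 * deriv y p.1) * x p.1 *
      Real.sin_sq_add_cos_sq p.2
  normal p v := by
    rw [h.fderiv_rotSurface, E4.inner_eq]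
    simp only [profileNormal, rotSurface, rotParallel, PiLp.add_apply, PiLp.smul_apply,
      smul_eq_mul, Matrix.cons_val]
    linear_combination v.1 * (y p.1 * deriv z p.1 - z p.1 * deriv y p.1) * deriv x p.1 *
      Real.sin_sq_add_cos_sq p.2

/-- A positive function `x` with `x² + ẋ² < 1` is the first coordinate of a profile curve, which
turns around the axis in the positive direction. -/
theorem exists_isProfileCurve {x k : ℝ → ℝ} (hx : ContDiff ℝ (⊤ : ℕ∞) x)
    (hk : ContDiff ℝ (⊤ : ℕ∞) k) (hx0 : ∀ s, 0 ≤ x s) (hk0 : ∀ s, 0 < k s)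
    (hxk : ∀ s, x s ^ 2 + deriv x s ^ 2 + k s ^ 2 = 1) :
    ∃ y z : ℝ → ℝ, IsProfileCurve x y z ∧ ∀ s, y s * deriv z s - z s * deriv y s = k s := by
  have hR2 : ∀ s, 0 < 1 - x s ^ 2 := fun s => by
    nlinarith [hxk s, pow_pos (hk0 s) 2, sq_nonneg (deriv x s)]
  have hR : ContDiff ℝ (⊤ : ℕ∞) fun s => √(1 - x s ^ 2) :=
    (contDiff_const.sub (hx.pow 2)).sqrt fun s => (hR2 s).ne'
  have hRpos : ∀ s, 0 < √(1 - x s ^ 2) := fun s => Real.sqrt_pos.2 (hR2 s)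
  have hRsq : ∀ s, √(1 - x s ^ 2) ^ 2 = 1 - x s ^ 2 := fun s => Real.sq_sqrt (hR2 s).le
  -- In polar coordinates `y ż - z ẏ = R² φ'`, so this choice of `φ'` makes it equal to `k`.
  obtain ⟨φ, hφ, hφd⟩ := exists_smooth_primitive (f := fun s => k s / (1 - x s ^ 2))
    (hk.div (contDiff_const.sub (hx.pow 2)) fun s => (hR2 s).ne')
  have hRd : ∀ s, HasDerivAt (fun s => √(1 - x s ^ 2))
      (-(x s * deriv x s) / √(1 - x s ^ 2)) s := fun s => by
    have h1 : HasDerivAt (fun s => 1 - x s ^ 2) (-(2 * x s * deriv x s)) s :=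
      (((hx.hasDerivAt_of_smooth s).pow 2).const_sub 1).congr_deriv (by norm_num)
    convert h1.sqrt (hR2 s).ne' using 1
    field_simp
  set R : ℝ → ℝ := fun s => √(1 - x s ^ 2) with hRdef
  have hyd : ∀ s, HasDerivAt (fun s => R s * Real.cos (φ s))
      (-(x s * deriv x s) / R s * Real.cos (φ s) +
        R s * (-Real.sin (φ s) * (k s / (1 - x s ^ 2)))) s :=
    fun s => (hRd s).mul (hφd s).cos
  have hzd : ∀ s, HasDerivAt (fun s => R s * Real.sin (φ s))
      (-(x s * deriv x s) / R s * Real.sin (φ s) +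
        R s * (Real.cos (φ s) * (k s / (1 - x s ^ 2)))) s :=
    fun s => (hRd s).mul (hφd s).sin
  refine ⟨fun s => R s * Real.cos (φ s), fun s => R s * Real.sin (φ s),
    ⟨hx, hR.mul hφ.cos, hR.mul hφ.sin, hx0, fun s => ?_, fun s => ?_⟩, fun s => ?_⟩
  · linear_combination R s ^ 2 * Real.sin_sq_add_cos_sq (φ s) + hRsq s
  · rw [(hyd s).deriv, (hzd s).deriv]
    have h0 := (hRpos s).ne'
    change R s ≠ 0 at h0
    have h1 : R s ^ 2 = 1 - x s ^ 2 := hRsq s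
    rw [← h1]
    have h2 : (-(x s * deriv x s) / R s) ^ 2 + (R s * (k s / R s ^ 2)) ^ 2 =
        1 - deriv x s ^ 2 := by
      field_simp
      linear_combination hxk s - (1 - deriv x s ^ 2) * h1
    linear_combination ((-(x s * deriv x s) / R s) ^ 2 + (R s * (k s / R s ^ 2)) ^ 2) *
      Real.sin_sq_add_cos_sq (φ s) + h2
  · rw [(hyd s).deriv, (hzd s).deriv]
    have h1 : R s ^ 2 = 1 - x s ^ 2 := hRsq s
    rw [← h1]
    have h0 := (hRpos s).ne'
    change R s ≠ 0 at h0
    have h2 : R s ^ 2 * (k s / R s ^ 2) = k s := by field_simp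
    linear_combination R s ^ 2 * (k s / R s ^ 2) * Real.sin_sq_add_cos_sq (φ s) + h2

/-- A solution of the equation of rotational linear Weingarten surfaces for the distance `x` to
the axis generates such a surface. -/
theorem exists_isRLWS {a b α : ℝ} {x k : ℝ → ℝ} (hx : ContDiff ℝ (⊤ : ℕ∞) x)
    (hk : ContDiff ℝ (⊤ : ℕ∞) k) (hx0 : ∀ s, 0 < x s) (hk0 : ∀ s, 0 < k s)
    (hxk : ∀ s, x s ^ 2 + deriv x s ^ 2 + k s ^ 2 = 1)
    (hode : ∀ s, a * (x s * (deriv (deriv x) s + x s) - k s ^ 2) =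
      2 * b * k s * (deriv (deriv x) s + x s))
    (hlev : ∀ s, a * x s * k s + b * (1 - k s ^ 2) = 2 * α) :
    ∃ (y z : ℝ → ℝ) (N : ℝ × ℝ → E4), IsRLWS a b 0 α x y z N := by
  obtain ⟨y, z, h, hw⟩ := exists_isProfileCurve hx hk (fun s => (hx0 s).le) hk0 hxk
  have hn : ∀ p : ℝ × ℝ, Real.cos p.2 * profileNormal x y z p 0 +
      Real.sin p.2 * profileNormal x y z p 1 = k p.1 := fun p => by
    simp only [profileNormal, rotSurface, Matrix.cons_val, hw]
    linear_combination k p.1 * Real.sin_sq_add_cos_sq p.2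
  refine ⟨y, z, profileNormal x y z, h, h.isUnitNormal_profileNormal, fun p => ?_, fun p => ?_,
    fun s => ?_⟩
  · rw [hn]; exact (hk0 _).le
  · obtain ⟨r, l, hr, -, hrl, hsf⟩ :=
      h.secondForm_rotSurface h.isUnitNormal_profileNormal p (hx0 p.1).ne'
    obtain ⟨hH, hK⟩ := h.meanCurv_gaussCurv (hx0 p.1).ne' hsf
    rw [hn] at hr
    rw [hH, hK, hr]
    rw [hr] at hrl
    have h1 := (hx0 p.1).ne'
    have h2 := (hk0 p.1).ne'
    have h3 := hode p.1
    rw [← hrl] at h3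
    field_simp
    apply mul_left_cancel₀ h2
    linear_combination h3
  · have h1 : 1 - x s ^ 2 - deriv x s ^ 2 = k s ^ 2 := by linarith [hxk s]
    rw [h1, Real.sqrt_sq (hk0 s).le]
    linear_combination hlev s / 2 + b / 2 * hxk s

/-! ### Global solutions of the profile equation. -/

/-- With `β = 2α - b`, the square `u` of the conjugate variable `√(1 - x² - ẋ²)` stays in a region
where the equation for `ẍ` does not degenerate. -/
theorem pos_of_level_region {a b β u : ℝ} (ha : 0 < a) (hβ : 0 < β) (hβb : 0 < β + b)
    (hdeg : a ^ 2 * b < β * (a ^ 2 + 4 * b ^ 2)) (hu : (β + b * u) ^ 2 ≤ a ^ 2 * (u - u ^ 2)) :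
    0 < u ∧ 0 < β + b * u ∧ 0 < β - b * u := by
  have ha2 : 0 < a ^ 2 := by positivity
  have h1 : 0 ≤ u - u ^ 2 := by
    by_contra! h
    nlinarith [sq_nonneg (β + b * u)]
  have hu0 : 0 < u := by
    rcases (show 0 ≤ u by nlinarith [sq_nonneg u]).eq_or_lt with h | h
    · rw [← h] at hu; nlinarith
    · exact h
  have hu1 : u ≤ 1 := by nlinarith
  refine ⟨hu0, ?_, ?_⟩
  · rcases le_total 0 b with hb | hb <;> nlinarith
  · by_contra! h
    have hb : 0 < b := by
      by_contra! hb
      nlinarith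
    -- Expanded in `t`, the defect in `hu` has positive coefficients, so `hu` fails for all `t ≥ 0`.
    -- The constant term is positive exactly by `hdeg`.
    obtain ⟨t, ht⟩ : ∃ t, t = b * u - β := ⟨_, rfl⟩
    have ht0 : 0 ≤ t := by linarith
    have e : b ^ 2 * (β + b * u) ^ 2 - b ^ 2 * (a ^ 2 * (u - u ^ 2)) =
        β * (β * (a ^ 2 + 4 * b ^ 2) - a ^ 2 * b) +
          t * ((β * (a ^ 2 + 4 * b ^ 2) - a ^ 2 * b) + a ^ 2 * β) + t ^ 2 * (a ^ 2 + b ^ 2) := by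
      rw [ht]; ring
    have hp : 0 < β * (a ^ 2 + 4 * b ^ 2) - a ^ 2 * b := by linarith
    have := mul_le_mul_of_nonneg_left hu (sq_nonneg b)
    have := mul_pos hβ hp
    have := mul_nonneg ht0 (add_pos hp (mul_pos ha2 hβ)).le
    have : 0 ≤ t ^ 2 * (a ^ 2 + b ^ 2) := by positivity
    linarith

/-- Global solutions of the equation of rotational linear Weingarten surfaces for the distance `x`
to the axis, together with the conjugate variable `k = √(1 - x² - ẋ²)`. -/
theorem exists_global_solution {a b β : ℝ} (ha : 0 < a) (hβ : 0 < β) (hβb : 0 < β + b)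
    (hdeg : a ^ 2 * b < β * (a ^ 2 + 4 * b ^ 2)) (hdisc : 0 ≤ a ^ 2 - 4 * β * b - 4 * β ^ 2) :
    ∃ x k : ℝ → ℝ, ContDiff ℝ (⊤ : ℕ∞) x ∧ ContDiff ℝ (⊤ : ℕ∞) k ∧ (∀ s, 0 < x s) ∧
      (∀ s, 0 < k s) ∧ (∀ s, x s ^ 2 + deriv x s ^ 2 + k s ^ 2 = 1) ∧
      (∀ s, a * (x s * (deriv (deriv x) s + x s) - k s ^ 2) =
        2 * b * k s * (deriv (deriv x) s + x s)) ∧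
      ∀ s, a * x s * k s + b * (1 - k s ^ 2) = β + b := by
  obtain ⟨d, hd0, hd⟩ : ∃ d : ℝ, 0 < d ∧ d ^ 2 = a ^ 2 + b ^ 2 :=
    ⟨√(a ^ 2 + b ^ 2), Real.sqrt_pos.2 (by positivity), Real.sq_sqrt (by positivity)⟩
  -- `m` is the vertex of the quadratic `-d² u² + (a² - 2βb) u - β²`, and `m ± r` are its roots;
  -- `hdisc` makes them real.
  obtain ⟨m, hm⟩ : ∃ m, m = (a ^ 2 - 2 * β * b) / (2 * d ^ 2) := ⟨_, rfl⟩
  obtain ⟨r, hr0, hr⟩ : ∃ r, 0 ≤ r ∧ d ^ 2 * r ^ 2 = d ^ 2 * m ^ 2 - β ^ 2 := by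
    refine ⟨a * √(a ^ 2 - 4 * β * b - 4 * β ^ 2) / (2 * d ^ 2), by positivity, ?_⟩
    rw [div_pow, mul_pow, Real.sq_sqrt hdisc, hm]
    field_simp
    rw [hd]
    ring
  have hm2 : 2 * d ^ 2 * m = a ^ 2 - 2 * β * b := by rw [hm]; field_simp
  have hquad : ∀ t, a ^ 2 * ((m + r * Real.cos t) - (m + r * Real.cos t) ^ 2) -
      (β + b * (m + r * Real.cos t)) ^ 2 = d ^ 2 * r ^ 2 * Real.sin t ^ 2 := by
    intro t
    linear_combination (m + r * Real.cos t) ^ 2 * hd - (m + r * Real.cos t) * hm2 - hr -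
      d ^ 2 * r ^ 2 * Real.sin_sq_add_cos_sq t
  have hpos : ∀ t, 0 < m + r * Real.cos t ∧ 0 < β + b * (m + r * Real.cos t) ∧
      0 < β - b * (m + r * Real.cos t) := by
    intro t
    apply pos_of_level_region ha hβ hβb hdeg
    have : 0 ≤ d ^ 2 * r ^ 2 * Real.sin t ^ 2 := by positivity
    linarith [hquad t]
  have hu : ContDiff ℝ (⊤ : ℕ∞) fun t => m + r * Real.cos t :=
    contDiff_const.add (contDiff_const.mul Real.contDiff_cos)
  -- Differentiating `x = (β + b u)/(a k)` and requiring `ẋ = d r sin θ/(a k)` gives `θ' = 2 d u/(β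
  -- - b u)`. The reciprocal decreases in `u`, so its minimum `δ` is at `u = m + r`.
  obtain ⟨θ, hθ, hθd⟩ := exists_smooth_autonomous_solution
    (f := fun t => (β / (m + r * Real.cos t) - b) / (2 * d))
    (δ := (β / (m + r) - b) / (2 * d))
    (((contDiff_const.div hu fun t => (hpos t).1.ne').sub contDiff_const).div_const _)
    (by
      have h0 := hpos 0
      rw [Real.cos_zero, mul_one] at h0
      have : 0 < β / (m + r) - b := by rw [sub_pos, lt_div_iff₀ h0.1]; linarith
      positivity)
    (fun t => by
      have h0 := (hpos t).1
      have h1 : r * Real.cos t ≤ r := mul_le_of_le_one_right hr0 (Real.cos_le_one t)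
      gcongr)
  set u : ℝ → ℝ := fun s => m + r * Real.cos (θ s) with hudef
  have hu0 : ∀ s, 0 < u s := fun s => (hpos (θ s)).1
  have hup : ∀ s, 0 < β + b * u s := fun s => (hpos (θ s)).2.1
  have hum : ∀ s, 0 < β - b * u s := fun s => (hpos (θ s)).2.2
  have huq : ∀ s, a ^ 2 * (u s - u s ^ 2) - (β + b * u s) ^ 2 =
      d ^ 2 * r ^ 2 * Real.sin (θ s) ^ 2 := fun s => hquad (θ s)
  have huc : ContDiff ℝ (⊤ : ℕ∞) u := hu.comp hθ
  have hkc : ContDiff ℝ (⊤ : ℕ∞) fun s => √(u s) := huc.sqrt fun s => (hu0 s).ne'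
  have hk0 : ∀ s, 0 < √(u s) := fun s => Real.sqrt_pos.2 (hu0 s)
  have hksq : ∀ s, √(u s) ^ 2 = u s := fun s => Real.sq_sqrt (hu0 s).le
  have hθd' : ∀ s, HasDerivAt θ (2 * d * u s / (β - b * u s)) s := fun s => by
    refine (hθd s).congr_deriv ?_
    change ((β / u s - b) / (2 * d))⁻¹ = _
    have h1 := (hu0 s).ne'
    have h2 := (hum s).ne'
    rw [inv_div, div_eq_div_iff (by rw [div_sub' h1, mul_comm]; exact div_ne_zero h2 h1) h2]
    field_simp
  have hud : ∀ s, HasDerivAt u (-(r * Real.sin (θ s)) * (2 * d * u s / (β - b * u s))) s :=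
    fun s => by
      have h1 := (((hθd' s).cos).const_mul r).const_add m
      exact h1.congr_deriv (by ring)
  have hkd : ∀ s, HasDerivAt (fun s => √(u s))
      (-(r * Real.sin (θ s)) * (d * √(u s) / (β - b * u s))) s := fun s => by
    refine ((hud s).sqrt (hu0 s).ne').congr_deriv ?_
    have h1 := (hk0 s).ne'
    have h2 := (hum s).ne'
    field_simp
    rw [hksq s]
  set k : ℝ → ℝ := fun s => √(u s) with hkdef
  have hkd' : ∀ s, HasDerivAt k (-(r * Real.sin (θ s)) * (d * k s / (β - b * u s))) s := hkd
  have hk0' : ∀ s, k s ≠ 0 := fun s => (hk0 s).ne'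
  have hksq' : ∀ s, u s = k s ^ 2 := fun s => (hksq s).symm
  have hxd : ∀ s, HasDerivAt (fun s => (β + b * u s) / (a * k s))
      (d * r * Real.sin (θ s) / (a * k s)) s := fun s => by
    refine ((((hud s).const_mul b).const_add β).div ((hkd s).const_mul a)
      (mul_ne_zero ha.ne' (hk0' s))).congr_deriv ?_
    have h1 := hk0' s
    have h2 := (hum s).ne'
    change (_ * (a * k s) - _ * (a * (_ * (d * k s / _)))) / _ = _
    rw [hksq'] at h2 ⊢
    field_simp
    ring
  set x : ℝ → ℝ := fun s => (β + b * u s) / (a * k s) with hxdef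
  have hxd1 : deriv x = fun s => d * r * Real.sin (θ s) / (a * k s) := funext fun s => (hxd s).deriv
  -- With `a x k = β + b k²` this is the Weingarten equation solved for `ẍ + x`.
  have hxdd : ∀ s, deriv (deriv x) s + x s = a * k s ^ 3 / (β - b * u s) := fun s => by
    have h0 : HasDerivAt (fun s => d * r * Real.sin (θ s) / (a * k s)) _ s :=
      (((hθd' s).sin.const_mul (d * r)).div ((hkd' s).const_mul a)
      (mul_ne_zero ha.ne' (hk0' s)))
    rw [hxd1, h0.deriv]
    have h1 := hk0' s
    have h2 := (hum s).ne'
    have h3 := huq s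
    have h4 : u s = m + r * Real.cos (θ s) := rfl
    have h5 : r * Real.cos (θ s) = u s - m := by rw [h4]; ring
    have e : x s = (β + b * u s) / (a * k s) := rfl
    rw [e]
    have key : 2 * d ^ 2 * u s * (r * Real.cos (θ s)) + d ^ 2 * r ^ 2 * Real.sin (θ s) ^ 2 =
        d ^ 2 * u s ^ 2 - β ^ 2 := by
      rw [h5, ← h3]
      linear_combination u s ^ 2 * hd - u s * hm2
    have key2 : (2 * d ^ 2 * u s * (r * Real.cos (θ s)) + d ^ 2 * r ^ 2 * Real.sin (θ s) ^ 2) /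
        (a * k s * (β - b * u s)) + (β + b * u s) / (a * k s) = a * k s ^ 3 / (β - b * u s) := by
      rw [key]
      have h6 : k s ^ 4 = u s ^ 2 := by rw [hksq' s]; ring
      obtain ⟨c, hc⟩ : ∃ c, c = β - b * u s := ⟨_, rfl⟩
      rw [← hc] at h2 ⊢
      field_simp
      linear_combination u s ^ 2 * hd + (β + b * u s) * hc - a ^ 2 * h6
    rw [← key2]
    congr 1
    field_simp
    rw [hksq' s]
    ring
  have hxc : ContDiff ℝ (⊤ : ℕ∞) x :=
    (contDiff_const.add (contDiff_const.mul huc)).div (contDiff_const.mul hkc)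
      fun s => mul_ne_zero ha.ne' (hk0' s)
  refine ⟨x, k, hxc, hkc, fun s => div_pos (hup s) (mul_pos ha (hk0 s)), hk0, fun s => ?_,
    fun s => ?_, fun s => ?_⟩
  · have h1 := hk0' s
    have h3 := huq s
    rw [hxd1]
    simp only [hxdef]
    rw [hksq' s] at h3 ⊢
    field_simp
    linear_combination -h3
  · rw [hxdd]
    have h1 := hk0' s
    have h2 := (hum s).ne'
    simp only [hxdef]
    rw [hksq' s] at h2 ⊢
    field_simp
    ring
  · have h1 := hk0' s
    simp only [hxdef]
    rw [hksq' s]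
    field_simp
    ring

/-! ### Comparison of the parameter bounds, and conclusion. -/

theorem half_lt_alphaOne {a b : ℝ} (ha : 0 < a) (hb : 0 < b) : b / 2 < alphaOne a b := by
  rw [alphaOne, div_lt_div_iff₀ two_pos (by positivity)]
  nlinarith [mul_pos hb (pow_pos ha 2)]

theorem alphaOne_neg {a b : ℝ} (ha : 0 < a) (hb : b < 0) : alphaOne a b < 0 :=
  div_neg_of_neg_of_pos (mul_neg_of_neg_of_pos hb (by positivity)) (by positivity)

theorem alphaZero_pos {a b : ℝ} (ha : 0 < a) : 0 < alphaZero a b 0 := by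
  have : |b| < √(a ^ 2 + b ^ 2) := Real.lt_sqrt_of_sq_lt (by rw [sq_abs]; nlinarith)
  have := (abs_lt.1 this).1
  rw [alphaZero, add_zero]
  linarith

theorem alphaOne_lt_alphaZero {a b : ℝ} (ha : 0 < a) : alphaOne a b < alphaZero a b 0 := by
  have hD : 0 < a ^ 2 + 4 * b ^ 2 := by positivity
  have h1 : b * (3 * a ^ 2 + 4 * b ^ 2) / (a ^ 2 + 4 * b ^ 2) < √(a ^ 2 + b ^ 2) := by
    apply Real.lt_sqrt_of_sq_lt
    rw [div_pow, div_lt_iff₀ (by positivity)]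
    -- `(a² + b²)(a² + 4b²)² - b²(3a² + 4b²)² = a⁶`.
    have : 0 < a ^ 6 := by positivity
    linarith
  have h2 : alphaOne a b = b * (3 * a ^ 2 + 4 * b ^ 2) / (a ^ 2 + 4 * b ^ 2) / 4 + b / 4 := by
    rw [alphaOne]
    field_simp
    ring
  rw [h2, alphaZero, add_zero]
  linarith

theorem IsRLWS.conclusions {a b α : ℝ} {x y z : ℝ → ℝ} {N : ℝ × ℝ → E4}
    (h : IsRLWS a b 0 α x y z N) (ha : 0 < a)
    (hα : α ∈ Ioo (max 0 (b / 2)) (alphaZero a b 0)) :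
    IsSphereImmersion (rotSurface x y z) ∧ IsInducedComplete (rotSurface x y z) ∧
      ¬ IsIsoparametric (rotSurface x y z) := by
  obtain ⟨c, hc, hcx⟩ := h.exists_le_of_level ha hα.1
  exact ⟨h.profile.isSphereImmersion fun s => hc.trans_le (hcx s).1,
    h.profile.isInducedComplete hc fun s => (hcx s).1, h.not_isIsoparametric ha hα⟩

theorem theorem2 (a b : ℝ) (ha : 0 < a) (hb : b ≠ 0) :
    -- the parameter interval of the family is a nonempty part of `(max {0, b/2}, α₀)`,
    -- and all of it if `b < 0`
    max 0 (b / 2) ≤ max 0 (alphaOne a b) ∧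
    max 0 (alphaOne a b) < alphaZero a b 0 ∧
    (b < 0 → max 0 (alphaOne a b) = max 0 (b / 2)) ∧
    -- to every parameter of the interval belongs a complete immersed, non-isoparametric surface
    (∀ α ∈ Set.Ioo (max 0 (alphaOne a b)) (alphaZero a b 0),
      ∃ (x y z : ℝ → ℝ) (N : ℝ × ℝ → E4), IsRLWS a b 0 α x y z N ∧
        IsSphereImmersion (rotSurface x y z) ∧ IsInducedComplete (rotSurface x y z) ∧
        ¬ IsIsoparametric (rotSurface x y z)) ∧
    -- every surface with parameter in `(max {0, b/2}, α₀)` is of this kind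
    (∀ α ∈ Set.Ioo (max 0 (b / 2)) (alphaZero a b 0),
      ∀ (x y z : ℝ → ℝ) (N : ℝ × ℝ → E4), IsRLWS a b 0 α x y z N →
        IsSphereImmersion (rotSurface x y z) ∧ IsInducedComplete (rotSurface x y z) ∧
        ¬ IsIsoparametric (rotSurface x y z)) := by
  have hle : max 0 (b / 2) ≤ max 0 (alphaOne a b) := by
    rcases hb.lt_or_gt with h | h
    · exact max_le (le_max_left _ _) (le_max_of_le_left (by linarith))
    · exact max_le_max_left _ (half_lt_alphaOne ha h).le
  refine ⟨hle, max_lt (alphaZero_pos ha) (alphaOne_lt_alphaZero ha), fun h => ?_, fun α hα => ?_,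
    fun α hα x y z N h => h.conclusions ha hα⟩
  · rw [max_eq_left (alphaOne_neg ha h).le, max_eq_left (by linarith)]
  · have hα' : α ∈ Ioo (max 0 (b / 2)) (alphaZero a b 0) := ⟨hle.trans_lt hα.1, hα.2⟩
    obtain ⟨h0, h1⟩ := max_lt_iff.1 hα'.1
    -- This is `α₁ < α` rewritten for `β = 2α - b`; likewise `a² - 4βb - 4β² = a² + b² - (4α - b)²`.
    have hdeg : a ^ 2 * b < (2 * α - b) * (a ^ 2 + 4 * b ^ 2) := by
      have h2 := (max_lt_iff.1 hα.1).2
      rw [alphaOne, div_lt_iff₀ (by positivity)] at h2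
      linarith
    have hdisc := sq_lt_of_mem_Ioo hα'
    obtain ⟨x, k, hx, hk, hx0, hk0, hxk, hode, hlev⟩ := exists_global_solution ha
      (by linarith : 0 < 2 * α - b) (by linarith) hdeg (by linarith)
    obtain ⟨y, z, N, h⟩ := exists_isRLWS hx hk hx0 hk0 hxk hode (α := α)
      fun s => by rw [hlev]; ring
    exact ⟨x, y, z, N, h, h.conclusions ha hα'⟩
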